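/- Let $\mathcal A$ be a closed bounded subset of a real locally convex space such that $\overline{\mathrm{co}}\,\mathcal A$ is a complete separable metric space, let $M(\mathcal A)$ be the set of Borel probability measures on $\mathcal A$ with the topology of weak convergence, and let $\mathbf b(\mu)=\int_{\mathcal A}x\,\mu(dx)\in\overline{\mathrm{co}}\,\mathcal A$ (Pettis integral) be the barycenter of $\mu\in M(\mathcal A)$. The set $\mathcal A$ is called $\mu$-compact if $\mathbf b^{-1}(\mathcal K)$ is a compact subset of $M(\mathcal A)$ for every compact $\mathcal K\subseteq\overline{\mathrm{co}}\,\mathcal A$, and pointwise $\mu$-compact if $\mathbf b^{-1}(\{x\})$ is a compact subset of $M(\mathcal A)$ for every $x\in\overline{\mathrm{co}}\,\mathcal A$. For $1\le p\le\infty$ let $\Delta_p=\{x\in \ell_p : x^i\ge 0 \text{ for all } i,\ \sum_{i=1}^{\infty}x^i\le 1\}$, a subset of the real sequence space $\ell_p$ with its norm topology. Proposition. For every $p$ with $1<p\le\infty$ the simplex $\Delta_p$ is pointwise $\mu$-compact but not $\mu$-compact; in particular, the two notions differ. Moreover, $\mu$-compactness is not preserved when the topology is weakened: $\Delta_1\subset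 \ell_1$ is $\mu$-compact, and the coordinatewise inclusion $\ell_1\to\ell_p$ is a continuous linear map that restricts to a bijection of $\Delta_1$ onto $\Delta_p$, so that $\Delta_p$ is the set $\Delta_1$ with a weaker topology. -/

import Mathlib

open MeasureTheory
open scoped ENNReal

noncomputable section

/-- The real sequence space `ℓ_p`, with sequences indexed by `ℕ`. -/
abbrev EllP (p : ℝ≥0∞) : Type := lp (fun _ : ℕ => ℝ) p

/-- `ℓ_p` carries the Borel σ-algebra of its norm topology. -/
instance EllP.instMeasurableSpace (p : ℝ≥0∞) [Fact (1 ≤ p)] : MeasurableSpace (EllP p) :=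
  borel (EllP p)

instance EllP.instBorelSpace (p : ℝ≥0∞) [Fact (1 ≤ p)] : BorelSpace (EllP p) :=
  ⟨rfl⟩

section MuCompact

variable {E : Type*} [AddCommGroup E] [Module ℝ E] [TopologicalSpace E] [MeasurableSpace E]

/-- `x` is the barycenter of the probability measure `μ` on `A`, that is, the Pettis integral
`∫_A y μ(dy)`: every continuous linear functional is `μ`-integrable and has integral `φ x`. -/
def HasBarycenter {A : Set E} (μ : ProbabilityMeasure A) (x : E) : Prop :=
  ∀ φ : E →L[ℝ] ℝ,
    Integrable (fun y : A => φ (y : E)) (μ : Measure A) ∧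
      ∫ y : A, φ (y : E) ∂(μ : Measure A) = φ x

/-- The set `M_x(A)` of Borel probability measures on `A` with barycenter `x`. -/
def measuresWithBarycenter (A : Set E) (x : E) : Set (ProbabilityMeasure A) :=
  {μ | HasBarycenter μ x}

/-- The preimage of `K` under the barycenter map on the Borel probability measures on `A`. -/
def barycenterPreimage (A K : Set E) : Set (ProbabilityMeasure A) :=
  {μ | ∃ x ∈ K, HasBarycenter μ x}

variable [BorelSpace E]

/-- `A` is μ-compact: for every compact subset `K` of the closed convex hull of `A`, the set of
Borel probability measures on `A` with barycenter in `K` is compact in the topology of weak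
convergence. -/
def IsMuCompact (A : Set E) : Prop :=
  ∀ K : Set E, K ⊆ closure (convexHull ℝ A) → IsCompact K → IsCompact (barycenterPreimage A K)

/-- `A` is pointwise μ-compact: for every point `x` of the closed convex hull of `A`, the set of
Borel probability measures on `A` with barycenter `x` is compact in the topology of weak
convergence. -/
def IsPointwiseMuCompact (A : Set E) : Prop :=
  ∀ x ∈ closure (convexHull ℝ A), IsCompact (measuresWithBarycenter A x)

end MuCompact

/-- The simplex `Δ_p = {x ∈ ℓ_p | x ≥ 0, ∑ xⁱ ≤ 1}`; the series is required to converge. -/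
def ellSimplex (p : ℝ≥0∞) : Set (EllP p) :=
  {x | (∀ i, 0 ≤ x i) ∧ Summable (fun i => x i) ∧ ∑' i, x i ≤ 1}

end

open Filter Topology

/-! Everything rests on one identity: coordinates on the simplex are nonnegative, so Tonelli gives
`∫⁻ seqTail n y dμ = seqTail n x` whenever `μ` has barycenter `x`
(`HasBarycenter.lintegral_seqTail`). If tails vanish uniformly on a compact `K`, Markov's inequality
makes the measures with barycenter in `K` tight, because sets with uniformly vanishing tails are
compact; Prokhorov and closedness of the preimage then give compactness
(`isCompact_barycenterPreimage`). A single point of the simplex always has vanishing tails; a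
compact subset of `ℓ₁` has them uniformly. For `p > 1` uniformity fails: the averages of the first
unit vectors tend to `0` in norm, while the uniform measures on these vectors keep mean norm `1`. A
cluster point would have barycenter `0`, hence sit at `0` by the identity, yet have mean norm `1`.
-/

/-- The `ℓ₁`-size of the part of a real sequence from index `n` on. -/
noncomputable def seqTail (n : ℕ) (x : ℕ → ℝ) : ℝ≥0∞ := ∑' i, ‖x (i + n)‖ₑ

theorem seqTail_add_le (n : ℕ) (x y : ℕ → ℝ) :
    seqTail n (fun i => x i + y i) ≤ seqTail n x + seqTail n y := by
  unfold seqTail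
  rw [← ENNReal.tsum_add]
  exact ENNReal.tsum_le_tsum fun i => enorm_add_le _ _

theorem seqTail_sub_le (n : ℕ) (x y : ℕ → ℝ) :
    seqTail n (fun i => x i - y i) ≤ seqTail n x + seqTail n y := by
  unfold seqTail
  rw [← ENNReal.tsum_add]
  exact ENNReal.tsum_le_tsum fun i => enorm_sub_le

theorem seqTail_zero_eq_add (n : ℕ) (x : ℕ → ℝ) :
    seqTail 0 x = ∑ i ∈ Finset.range n, ‖x i‖ₑ + seqTail n x := by
  unfold seqTail
  exact (ENNReal.summable.sum_add_tsum_nat_add' (f := fun i => ‖x i‖ₑ) (k := n)).symm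

theorem seqTail_le_seqTail_zero (n : ℕ) (x : ℕ → ℝ) : seqTail n x ≤ seqTail 0 x := by
  rw [seqTail_zero_eq_add n x]
  exact le_add_self

theorem tendsto_seqTail {x : ℕ → ℝ} (hx : seqTail 0 x ≠ ∞) :
    Tendsto (fun n => seqTail n x) atTop (𝓝 0) :=
  ENNReal.tendsto_sum_nat_add (fun i => ‖x i‖ₑ) hx

/-- The tail is a supremum of finite sums, hence lower semicontinuous already for coordinatewise
convergence. -/
theorem isClosed_setOf_seqTail_le (n : ℕ) (c : ℝ≥0∞) : IsClosed {x : ℕ → ℝ | seqTail n x ≤ c} := by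
  have : {x : ℕ → ℝ | seqTail n x ≤ c} =
      ⋂ s : Finset ℕ, {x | ∑ i ∈ s, ‖x (i + n)‖ₑ ≤ c} := by
    ext x
    simp [seqTail, ENNReal.tsum_eq_iSup_sum]
  rw [this]
  exact isClosed_iInter fun s => isClosed_le (by fun_prop) continuous_const

/-! ### The simplex and the inclusion of `ℓ₁` -/

theorem mem_ellSimplex_iff {p : ℝ≥0∞} {x : EllP p} :
    x ∈ ellSimplex p ↔ (∀ i, 0 ≤ x i) ∧ seqTail 0 x ≤ 1 := by
  refine and_congr_right fun h0 => ?_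
  have key : seqTail 0 x = ∑' i, ENNReal.ofReal (x i) :=
    tsum_congr fun i => Real.enorm_of_nonneg (h0 i)
  constructor
  · rintro ⟨hs, h1⟩
    rw [key, ← ENNReal.ofReal_tsum_of_nonneg h0 hs]
    exact ENNReal.ofReal_le_one.2 h1
  · intro h
    have hs : Summable fun i => x i := by
      have := ENNReal.summable_toReal (f := fun i => ENNReal.ofReal (x i))
        (by rw [← key]; exact ne_top_of_le_ne_top ENNReal.one_ne_top h)
      simpa [ENNReal.toReal_ofReal, h0] using this
    refine ⟨hs, ?_⟩
    rwa [key, ← ENNReal.ofReal_tsum_of_nonneg h0 hs, ENNReal.ofReal_le_one] at h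

/-- The triangle inequality bounds the finite truncations, and the bound survives coordinatewise
limits, uniformly in `p` including `∞`. -/
theorem enorm_le_seqTail {p : ℝ≥0∞} [Fact (1 ≤ p)] (x : EllP p) : ‖x‖ₑ ≤ seqTail 0 x := by
  by_cases hx : seqTail 0 x = ∞
  · simp [hx]
  have hF : ∀ n, ‖∑ i ∈ Finset.range n, lp.single (E := fun _ : ℕ => ℝ) p i (x i)‖ ≤
      (seqTail 0 x).toReal := by
    intro n
    refine (norm_sum_le _ _).trans ?_
    have h1 : ∀ i, ‖lp.single (E := fun _ : ℕ => ℝ) p i (x i)‖ = (‖x i‖ₑ).toReal := fun i => by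
      rw [lp.norm_single (zero_lt_one.trans_le Fact.out), toReal_enorm]
    rw [Finset.sum_congr rfl fun i _ => h1 i, ← ENNReal.toReal_sum fun i _ => enorm_ne_top]
    refine ENNReal.toReal_mono hx ?_
    rw [seqTail_zero_eq_add n]
    exact le_self_add
  have hlim : Tendsto (id fun n => ⇑(∑ i ∈ Finset.range n,
      lp.single (E := fun _ : ℕ => ℝ) p i (x i)) : ℕ → ∀ _ : ℕ, ℝ) atTop (𝓝 x) := by
    refine tendsto_pi_nhds.2 fun j => tendsto_const_nhds.congr' ?_
    filter_upwards [eventually_gt_atTop j] with n hn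
    change x j = (∑ i ∈ Finset.range n, lp.single (E := fun _ : ℕ => ℝ) p i (x i) : EllP p) j
    rw [lp.coeFn_sum, Finset.sum_apply]
    simp [Finset.sum_pi_single, hn]
  have := lp.norm_le_of_tendsto (Eventually.of_forall hF) hlim
  rw [← ofReal_norm]
  exact ENNReal.ofReal_le_of_le_toReal this

theorem enorm_eq_seqTail (x : EllP 1) : ‖x‖ₑ = seqTail 0 x := by
  have h := lp.hasSum_norm (p := 1) (by simp) x
  simp only [ENNReal.toReal_one, Real.rpow_one] at h
  rw [← ofReal_norm, ← h.tsum_eq, ENNReal.ofReal_tsum_of_nonneg (fun _ => norm_nonneg _)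
    h.summable]
  exact tsum_congr fun i => ofReal_norm _

theorem continuous_ellP_coe (p : ℝ≥0∞) [Fact (1 ≤ p)] : Continuous fun x : EllP p => (x : ℕ → ℝ) :=
  (lp.uniformContinuous_coe (E := fun _ : ℕ => ℝ) (p := p)).continuous

theorem isClosed_ellSimplex (p : ℝ≥0∞) [Fact (1 ≤ p)] : IsClosed (ellSimplex p) := by
  have : ellSimplex p = (⋂ i, {x : EllP p | 0 ≤ x i}) ∩
      (fun x : EllP p => (x : ℕ → ℝ)) ⁻¹' {x | seqTail 0 x ≤ 1} := by
    ext x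
    simp [mem_ellSimplex_iff]
  rw [this]
  exact (isClosed_iInter fun i => isClosed_le continuous_const
    ((continuous_apply i).comp (continuous_ellP_coe p))).inter
    ((isClosed_setOf_seqTail_le 0 1).preimage (continuous_ellP_coe p))

theorem convex_ellSimplex (p : ℝ≥0∞) : Convex ℝ (ellSimplex p) := by
  rintro x ⟨hx0, hxs, hx1⟩ y ⟨hy0, hys, hy1⟩ a b ha hb hab
  have hs := (hxs.mul_left a).add (hys.mul_left b)
  refine ⟨fun i => add_nonneg (mul_nonneg ha (hx0 i)) (mul_nonneg hb (hy0 i)), hs, ?_⟩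
  change ∑' i, (a * x i + b * y i) ≤ 1
  rw [(hxs.mul_left a).tsum_add (hys.mul_left b), tsum_mul_left, tsum_mul_left]
  nlinarith

theorem closure_convexHull_ellSimplex (p : ℝ≥0∞) [Fact (1 ≤ p)] :
    closure (convexHull ℝ (ellSimplex p)) = ellSimplex p := by
  rw [(convex_ellSimplex p).convexHull_eq, (isClosed_ellSimplex p).closure_eq]

theorem norm_le_one_of_mem_ellSimplex {p : ℝ≥0∞} [Fact (1 ≤ p)] {x : EllP p}
    (hx : x ∈ ellSimplex p) : ‖x‖ ≤ 1 := by
  have := (enorm_le_seqTail x).trans (mem_ellSimplex_iff.1 hx).2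
  rwa [← ofReal_norm, ENNReal.ofReal_le_one] at this

theorem memℓp_of_seqTail_ne_top {p : ℝ≥0∞} [Fact (1 ≤ p)] {x : ℕ → ℝ} (hx : seqTail 0 x ≠ ∞) :
    Memℓp x p := by
  refine Memℓp.of_exponent_ge (memℓp_gen ?_) (Fact.out : 1 ≤ p)
  have := ENNReal.summable_toReal hx
  simpa using this

/-- The inclusion of `ℓ₁` into `ℓ_p` as a continuous linear map. -/
noncomputable def ellOneInclusion (p : ℝ≥0∞) [Fact (1 ≤ p)] : EllP 1 →L[ℝ] EllP p :=
  (lp.linearMapOfLE ℝ (fun _ : ℕ => ℝ) (Fact.out : 1 ≤ p)).mkContinuous 1 fun x => by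
    have h := enorm_le_seqTail (lp.linearMapOfLE ℝ (fun _ : ℕ => ℝ) (Fact.out : 1 ≤ p) x)
    rw [lp.coe_linearMapOfLE_apply, ← enorm_eq_seqTail] at h
    rw [one_mul]
    exact enorm_le_iff_norm_le.1 h

theorem coe_ellOneInclusion (p : ℝ≥0∞) [Fact (1 ≤ p)] (x : EllP 1) :
    (ellOneInclusion p x : ℕ → ℝ) = x :=
  lp.coe_linearMapOfLE_apply (𝕜 := ℝ) (Fact.out : 1 ≤ p) x

theorem ellOneInclusion_mem_ellSimplex_iff (p : ℝ≥0∞) [Fact (1 ≤ p)] (x : EllP 1) :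
    ellOneInclusion p x ∈ ellSimplex p ↔ x ∈ ellSimplex 1 := by
  rw [mem_ellSimplex_iff, mem_ellSimplex_iff, coe_ellOneInclusion]

theorem bijOn_ellOneInclusion (p : ℝ≥0∞) [Fact (1 ≤ p)] :
    Set.BijOn (ellOneInclusion p) (ellSimplex 1) (ellSimplex p) := by
  refine ⟨fun x hx => (ellOneInclusion_mem_ellSimplex_iff p x).2 hx, fun x _ y _ h => ?_,
    fun y hy => ?_⟩
  · apply lp.ext
    rw [← coe_ellOneInclusion p x, h, coe_ellOneInclusion]
  · have hm : Memℓp (y : ℕ → ℝ) 1 := memℓp_of_seqTail_ne_top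
      (ne_top_of_le_ne_top ENNReal.one_ne_top (mem_ellSimplex_iff.1 hy).2)
    have he : ellOneInclusion p (⟨y, hm⟩ : EllP 1) = y := by
      apply lp.ext
      rw [coe_ellOneInclusion]
    refine ⟨⟨y, hm⟩, ?_, he⟩
    rw [← ellOneInclusion_mem_ellSimplex_iff p, he]
    exact hy

/-! ### Compactness and uniformly vanishing tails -/

/-- Subsets of the simplex with uniformly vanishing tails are relatively compact. -/
theorem isCompact_setOf_seqTail_le (p : ℝ≥0∞) [Fact (1 ≤ p)] (n : ℕ → ℕ) {δ : ℕ → ℝ≥0∞}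
    (hδ : Tendsto δ atTop (𝓝 0)) :
    IsCompact {x : EllP p | x ∈ ellSimplex p ∧ ∀ k, seqTail (n k) x ≤ δ k} := by
  set S : Set (ℕ → ℝ) := {x | (∀ i, 0 ≤ x i) ∧ seqTail 0 x ≤ 1 ∧ ∀ k, seqTail (n k) x ≤ δ k}
    with hS
  have hSc : IsCompact S := by
    refine (isCompact_univ_pi fun _ : ℕ => isCompact_Icc (a := (0 : ℝ)) (b := 1)).of_isClosed_subset
      ?_ ?_
    · have : S = (⋂ i, {x | 0 ≤ x i}) ∩ ({x | seqTail 0 x ≤ 1} ∩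
          ⋂ k, {x | seqTail (n k) x ≤ δ k}) := by
        ext x
        simp [hS]
      rw [this]
      exact (isClosed_iInter fun i => isClosed_le continuous_const (continuous_apply i)).inter
        ((isClosed_setOf_seqTail_le 0 1).inter
          (isClosed_iInter fun k => isClosed_setOf_seqTail_le _ _))
    · rintro x ⟨h0, h1, -⟩ i -
      refine ⟨h0 i, ?_⟩
      have : ‖x i‖ₑ ≤ 1 := (ENNReal.le_tsum (f := fun i => ‖x i‖ₑ) i).trans h1
      rwa [Real.enorm_of_nonneg (h0 i), ENNReal.ofReal_le_one] at this
  let g : S → EllP p := fun x => ⟨x.1, memℓp_of_seqTail_ne_top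
    (ne_top_of_le_ne_top ENNReal.one_ne_top x.2.2.1)⟩
  -- On `S` coordinatewise closeness implies norm closeness: `ε / 2` pays for finitely many
  -- coordinates, `ε / 4` for each of the two tails.
  have hg : Continuous g := by
    rw [continuous_iff_continuousAt]
    intro z
    rw [ContinuousAt, Metric.nhds_basis_closedEBall.tendsto_right_iff]
    intro ε hε
    have hε4 : 0 < ε / 2 / 2 := ENNReal.half_pos (ENNReal.half_pos hε.ne').ne'
    obtain ⟨k, hk⟩ := (hδ.eventually (ge_mem_nhds hε4)).exists
    have hc : Tendsto (fun w : S => ∑ i ∈ Finset.range (n k), ‖w.1 i - z.1 i‖ₑ) (𝓝 z) (𝓝 0) := by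
      have : Continuous fun w : S => ∑ i ∈ Finset.range (n k), ‖w.1 i - z.1 i‖ₑ :=
        continuous_finsetSum _ fun i _ => continuous_enorm.comp
          (((continuous_apply i).comp continuous_subtype_val).sub continuous_const)
      simpa using this.tendsto z
    filter_upwards [hc.eventually (ge_mem_nhds (ENNReal.half_pos hε.ne'))] with w hw
    rw [Metric.mem_closedEBall, edist_eq_enorm_sub]
    refine (enorm_le_seqTail _).trans ?_
    rw [seqTail_zero_eq_add (n k), ← ENNReal.add_halves ε]
    refine add_le_add hw ((seqTail_sub_le (n k) w.1 z.1).trans ?_)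
    rw [← ENNReal.add_halves (ε / 2)]
    exact add_le_add ((w.2.2.2 k).trans hk) ((z.2.2.2 k).trans hk)
  have : {x : EllP p | x ∈ ellSimplex p ∧ ∀ k, seqTail (n k) x ≤ δ k} = Set.range g := by
    ext x
    rw [Set.mem_ofPred_eq, mem_ellSimplex_iff]
    constructor
    · rintro ⟨⟨h0, h1⟩, h2⟩
      exact ⟨⟨x, h0, h1, h2⟩, rfl⟩
    · rintro ⟨w, rfl⟩
      exact ⟨⟨w.2.1, w.2.2.1⟩, w.2.2.2⟩
  rw [this]
  have := isCompact_iff_compactSpace.1 hSc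
  exact isCompact_range hg

/-- A finite `ε / 2`-net reduces this to finitely many tails. Here `p = 1` matters: the norm itself
controls the tail of `x - y`. -/
theorem exists_seqTail_le_of_isCompact {K : Set (EllP 1)} (hK : IsCompact K) {ε : ℝ≥0∞}
    (hε : 0 < ε) : ∃ n, ∀ x ∈ K, seqTail n x ≤ ε := by
  obtain ⟨t, -, ht, hKt⟩ := EMetric.totallyBounded_iff'.1 hK.totallyBounded (ε / 2)
    (ENNReal.half_pos hε.ne')
  have hev : ∀ᶠ n in atTop, ∀ y ∈ t, seqTail n y ≤ ε / 2 := by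
    rw [ht.eventually_all]
    intro y _
    exact (tendsto_seqTail (by rw [← enorm_eq_seqTail]; exact enorm_ne_top)).eventually
      (ge_mem_nhds (ENNReal.half_pos hε.ne'))
  obtain ⟨n, hn⟩ := hev.exists
  refine ⟨n, fun x hx => ?_⟩
  obtain ⟨y, hy, hxy⟩ := Set.mem_iUnion₂.1 (hKt hx)
  have h1 : seqTail n x ≤ seqTail n y + seqTail n (x - y : EllP 1) := by
    have := seqTail_add_le n y (x - y : EllP 1)
    simpa using this
  rw [← ENNReal.add_halves ε]
  refine h1.trans (add_le_add (hn y hy) ((seqTail_le_seqTail_zero _ _).trans ?_))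
  rw [← enorm_eq_seqTail, ← edist_eq_enorm_sub]
  exact (Metric.mem_eball.1 hxy).le

/-! ### Closedness and tightness of barycenter preimages -/

section Barycenter

variable {p : ℝ≥0∞} [Fact (1 ≤ p)]

/-- A continuous linear functional as a bounded continuous function on the simplex. -/
noncomputable def simplexFunctional (φ : EllP p →L[ℝ] ℝ) :
    BoundedContinuousFunction (ellSimplex p) ℝ :=
  BoundedContinuousFunction.ofNormedAddCommGroup (fun y => φ y)
    (φ.continuous.comp continuous_subtype_val) ‖φ‖ fun y =>
      (φ.le_opNorm _).trans
        (mul_le_of_le_one_right (norm_nonneg _) (norm_le_one_of_mem_ellSimplex y.2))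

/-- The norm as a bounded continuous function on the simplex. -/
noncomputable def simplexNorm : BoundedContinuousFunction (ellSimplex p) ℝ :=
  BoundedContinuousFunction.ofNormedAddCommGroup (fun y => ‖(y : EllP p)‖)
    (continuous_norm.comp continuous_subtype_val) 1 fun y => by
      rw [norm_norm]
      exact norm_le_one_of_mem_ellSimplex y.2

theorem simplexNorm_apply (y : ellSimplex p) : simplexNorm y = ‖(y : EllP p)‖ := rfl

theorem hasBarycenter_iff {μ : ProbabilityMeasure (ellSimplex p)} {x : EllP p} :
    HasBarycenter μ x ↔
      ∀ φ : EllP p →L[ℝ] ℝ, ∫ y, simplexFunctional φ y ∂(μ : Measure (ellSimplex p)) = φ x :=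
  forall_congr' fun φ => and_iff_right ((simplexFunctional φ).integrable _)

theorem isClosed_setOf_hasBarycenter :
    IsClosed {q : EllP p × ProbabilityMeasure (ellSimplex p) | HasBarycenter q.2 q.1} := by
  simp only [hasBarycenter_iff, Set.ofPred_forall]
  exact isClosed_iInter fun φ => isClosed_eq
    ((ProbabilityMeasure.continuous_integral_boundedContinuousFunction _).comp continuous_snd)
    (φ.continuous.comp continuous_fst)

/-- Projection along the compact factor `K` is a closed map. -/
theorem isClosed_barycenterPreimage {K : Set (EllP p)} (hK : IsCompact K) :
    IsClosed (barycenterPreimage (ellSimplex p) K) := by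
  have := isCompact_iff_compactSpace.1 hK
  have h : barycenterPreimage (ellSimplex p) K = Prod.snd ''
      {q : K × ProbabilityMeasure (ellSimplex p) | HasBarycenter q.2 (q.1 : EllP p)} := by
    ext μ
    simp [barycenterPreimage]
  rw [h]
  exact isClosedMap_snd_of_compactSpace _ (isClosed_setOf_hasBarycenter.preimage
    ((continuous_subtype_val.comp continuous_fst).prodMk continuous_snd))

theorem measurable_coord (i : ℕ) : Measurable fun y : ellSimplex p => (y : EllP p) i :=
  (((continuous_apply i).comp (continuous_ellP_coe p)).comp continuous_subtype_val).measurable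

theorem measurable_seqTail (n : ℕ) : Measurable fun y : ellSimplex p => seqTail n (y : EllP p) :=
  Measurable.tsum fun i => (measurable_coord (i + n)).enorm

theorem HasBarycenter.integral_coord {μ : ProbabilityMeasure (ellSimplex p)} {x : EllP p}
    (h : HasBarycenter μ x) (i : ℕ) :
    Integrable (fun y : ellSimplex p => (y : EllP p) i) (μ : Measure (ellSimplex p)) ∧
      ∫ y : ellSimplex p, (y : EllP p) i ∂(μ : Measure (ellSimplex p)) = x i :=
  h (lp.evalCLM ℝ (fun _ : ℕ => ℝ) p i)

theorem HasBarycenter.lintegral_seqTail {μ : ProbabilityMeasure (ellSimplex p)} {x : EllP p}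
    (h : HasBarycenter μ x) (n : ℕ) :
    ∫⁻ y : ellSimplex p, seqTail n (y : EllP p) ∂(μ : Measure (ellSimplex p)) = seqTail n x := by
  unfold seqTail
  rw [lintegral_tsum fun i => (measurable_coord (i + n)).enorm.aemeasurable]
  refine tsum_congr fun i => ?_
  obtain ⟨hi, he⟩ := h.integral_coord (i + n)
  rw [← he, Real.enorm_of_nonneg (integral_nonneg fun y => y.2.1 (i + n)),
    ofReal_integral_eq_lintegral_ofReal hi (Eventually.of_forall fun y => y.2.1 (i + n))]
  exact lintegral_congr fun y => Real.enorm_of_nonneg (y.2.1 (i + n))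

theorem isTightMeasureSet_barycenterPreimage {K : Set (EllP p)}
    (hK : ∀ ε : ℝ≥0∞, 0 < ε → ∃ n, ∀ x ∈ K, seqTail n x ≤ ε) :
    IsTightMeasureSet {((μ : ProbabilityMeasure (ellSimplex p)) : Measure (ellSimplex p)) |
      μ ∈ barycenterPreimage (ellSimplex p) K} := by
  rw [isTightMeasureSet_iff_exists_isCompact_measure_compl_le]
  intro ε hε
  obtain ⟨ε', hε'0, hε'⟩ := ENNReal.exists_pos_sum_of_countable' hε.ne' ℕ
  obtain ⟨δ, -, hδ0, hδ⟩ := exists_seq_strictAnti_tendsto' (zero_lt_one (α := ℝ≥0∞))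
  have hδpos : ∀ k, δ k ≠ 0 := fun k => (hδ0 k).1.ne'
  have hδtop : ∀ k, δ k ≠ ∞ := fun k => ((hδ0 k).2.trans ENNReal.one_lt_top).ne
  -- Markov at level `δ k` divides by `δ k`, leaving the summable `ε' k`.
  choose n hn using fun k => hK (ε' k * δ k) (ENNReal.mul_pos (hε'0 k).ne' (hδpos k))
  have hC := isCompact_setOf_seqTail_le p n hδ
  refine ⟨Subtype.val ⁻¹' {x : EllP p | x ∈ ellSimplex p ∧ ∀ k, seqTail (n k) x ≤ δ k}, ?_, ?_⟩
  · exact (isClosed_ellSimplex p).isClosedEmbedding_subtypeVal.isCompact_preimage hC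
  · rintro _ ⟨μ, ⟨x, hx, hμ⟩, rfl⟩
    calc (μ : Measure (ellSimplex p)) _
        ≤ (μ : Measure (ellSimplex p))
            (⋃ k, {y : ellSimplex p | δ k ≤ seqTail (n k) (y : EllP p)}) := by
          refine measure_mono fun y hy => ?_
          by_contra hne
          simp only [Set.mem_iUnion, Set.mem_ofPred_eq, not_exists, not_le] at hne
          exact hy ⟨y.2, fun k => (hne k).le⟩
      _ ≤ ∑' k, (μ : Measure (ellSimplex p))
            {y : ellSimplex p | δ k ≤ seqTail (n k) (y : EllP p)} :=
          measure_iUnion_le _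
      _ ≤ ∑' k, ε' k := ENNReal.tsum_le_tsum fun k => by
          refine (meas_ge_le_lintegral_div (measurable_seqTail (n k)).aemeasurable (hδpos k)
            (hδtop k)).trans ?_
          rw [hμ.lintegral_seqTail]
          exact ENNReal.div_le_of_le_mul (hn k x hx)
      _ ≤ ε := hε'.le

theorem isCompact_barycenterPreimage {K : Set (EllP p)} (hKc : IsCompact K)
    (hK : ∀ ε : ℝ≥0∞, 0 < ε → ∃ n, ∀ x ∈ K, seqTail n x ≤ ε) :
    IsCompact (barycenterPreimage (ellSimplex p) K) := by
  rw [← (isClosed_barycenterPreimage hKc).closure_eq]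
  exact isCompact_closure_of_isTightMeasureSet (isTightMeasureSet_barycenterPreimage hK)

end Barycenter

theorem isPointwiseMuCompact_ellSimplex (p : ℝ≥0∞) [Fact (1 ≤ p)] :
    IsPointwiseMuCompact (ellSimplex p) := by
  intro x hx
  rw [closure_convexHull_ellSimplex] at hx
  have h : measuresWithBarycenter (ellSimplex p) x = barycenterPreimage (ellSimplex p) {x} := by
    ext μ
    simp [measuresWithBarycenter, barycenterPreimage]
  rw [h]
  refine isCompact_barycenterPreimage isCompact_singleton fun ε hε => ?_
  obtain ⟨n, hn⟩ := ((tendsto_seqTail (ne_top_of_le_ne_top ENNReal.one_ne_top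
    (mem_ellSimplex_iff.1 hx).2)).eventually (ge_mem_nhds hε)).exists
  exact ⟨n, by simpa using hn⟩

theorem isMuCompact_ellSimplex_one : IsMuCompact (ellSimplex 1) :=
  fun _ _ hK => isCompact_barycenterPreimage hK fun _ hε => exists_seqTail_le_of_isCompact hK hε

/-! ### Failure of μ-compactness for `p > 1` -/

section NotMuCompact

variable {p : ℝ≥0∞} [Fact (1 ≤ p)]

theorem single_mem_ellSimplex (p : ℝ≥0∞) (i : ℕ) :
    lp.single (E := fun _ : ℕ => ℝ) p i 1 ∈ ellSimplex p := by
  have h := hasSum_pi_single i (1 : ℝ)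
  exact ⟨fun j => by
    rw [lp.single_apply]; exact (Pi.single_nonneg.2 zero_le_one : (0 : ℕ → ℝ) ≤ Pi.single i 1) j,
    h.summable, h.tsum_eq.le⟩

/-- The uniform distribution on the first `n + 1` unit vectors. -/
noncomputable def uniformOnUnitVectors (p : ℝ≥0∞) [Fact (1 ≤ p)] (n : ℕ) :
    ProbabilityMeasure (ellSimplex p) :=
  ⟨((n : ℝ≥0∞) + 1)⁻¹ • ∑ i ∈ Finset.range (n + 1),
      Measure.dirac (⟨_, single_mem_ellSimplex p i⟩ : ellSimplex p), ⟨by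
    simp only [Measure.smul_apply, Measure.finsetSum_apply, measure_univ, Finset.sum_const,
      Finset.card_range, smul_eq_mul, nsmul_eq_mul, mul_one, Nat.cast_add, Nat.cast_one]
    exact ENNReal.inv_mul_cancel (by simp) (by simp)⟩⟩

theorem integral_uniformOnUnitVectors (n : ℕ) (f : BoundedContinuousFunction (ellSimplex p) ℝ) :
    ∫ y, f y ∂(uniformOnUnitVectors p n : Measure (ellSimplex p)) =
      ((n : ℝ) + 1)⁻¹ * ∑ i ∈ Finset.range (n + 1), f ⟨_, single_mem_ellSimplex p i⟩ := by
  change ∫ y, f y ∂(((n : ℝ≥0∞) + 1)⁻¹ • ∑ i ∈ Finset.range (n + 1),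
      Measure.dirac (⟨_, single_mem_ellSimplex p i⟩ : ellSimplex p)) = _
  rw [integral_smul_measure, integral_finsetSum_measure fun i _ => f.integrable _, smul_eq_mul]
  congr 1
  · rw [ENNReal.toReal_inv, ENNReal.toReal_add (by simp) (by simp)]
    simp
  · exact Finset.sum_congr rfl fun i _ => integral_dirac _ _

/-- The average of the first `n + 1` unit vectors. -/
noncomputable def averageUnitVector (p : ℝ≥0∞) (n : ℕ) : EllP p :=
  ((n : ℝ) + 1)⁻¹ • ∑ i ∈ Finset.range (n + 1), lp.single (E := fun _ : ℕ => ℝ) p i 1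

theorem hasBarycenter_uniformOnUnitVectors (n : ℕ) :
    HasBarycenter (uniformOnUnitVectors p n) (averageUnitVector p n) := by
  rw [hasBarycenter_iff]
  intro φ
  rw [integral_uniformOnUnitVectors, averageUnitVector, map_smul, map_sum, smul_eq_mul]
  rfl

theorem averageUnitVector_mem_ellSimplex (p : ℝ≥0∞) (n : ℕ) : averageUnitVector p n ∈ ellSimplex p := by
  rw [averageUnitVector, Finset.smul_sum]
  refine (convex_ellSimplex p).sum_mem (fun i _ => by positivity) ?_
    fun i _ => single_mem_ellSimplex p i
  simp only [Finset.sum_const, Finset.card_range, nsmul_eq_mul, Nat.cast_add, Nat.cast_one]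
  exact mul_inv_cancel₀ (by positivity)

theorem norm_sum_unitVectors_le (p : ℝ≥0∞) [Fact (1 ≤ p)] (m : ℕ) :
    ‖∑ i ∈ Finset.range m, lp.single (E := fun _ : ℕ => ℝ) p i 1‖ ≤ (m : ℝ) ^ (p.toReal)⁻¹ := by
  have hp0 : p ≠ 0 := (zero_lt_one.trans_le (Fact.out : 1 ≤ p)).ne'
  rcases eq_or_ne p ∞ with rfl | hp
  · rw [ENNReal.toReal_top, inv_zero, Real.rpow_zero]
    refine lp.norm_le_of_forall_le zero_le_one fun j => ?_
    rw [lp.coeFn_sum, Finset.sum_apply]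
    simp only [lp.single_apply, Finset.sum_pi_single]
    split_ifs <;> simp
  · have hpos := ENNReal.toReal_pos hp0 hp
    have h := lp.norm_sum_single hpos (fun _ : ℕ => (1 : ℝ)) (Finset.range m)
    simp only [norm_one, Real.one_rpow, Finset.sum_const, Finset.card_range, nsmul_eq_mul,
      mul_one] at h
    rw [← h, Real.rpow_rpow_inv (norm_nonneg _) hpos.ne']

theorem tendsto_averageUnitVector (hp : 1 < p) :
    Tendsto (averageUnitVector p) atTop (𝓝 0) := by
  have hs : 0 < 1 - (p.toReal)⁻¹ := by
    rcases eq_or_ne p ∞ with rfl | hp'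
    · simp
    · have : 1 < p.toReal := by
        rw [← ENNReal.toReal_one]
        exact (ENNReal.toReal_lt_toReal ENNReal.one_ne_top hp').2 hp
      exact sub_pos.2 (inv_lt_one_of_one_lt₀ this)
  refine squeeze_zero_norm (fun n => ?_) ((tendsto_rpow_neg_atTop hs).comp
    (tendsto_natCast_atTop_atTop.comp (tendsto_add_atTop_nat 1)))
  have hn : (0 : ℝ) < ((n + 1 : ℕ) : ℝ) := by positivity
  rw [averageUnitVector, norm_smul, ← Nat.cast_add_one, norm_inv, Real.norm_of_nonneg hn.le]
  refine (mul_le_mul_of_nonneg_left (norm_sum_unitVectors_le p (n + 1))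
    (inv_nonneg.2 hn.le)).trans_eq ?_
  simp only [Function.comp_apply]
  rw [neg_sub, Real.rpow_sub_one hn.ne', div_eq_inv_mul]

theorem not_isMuCompact_ellSimplex (hp : 1 < p) : ¬ IsMuCompact (ellSimplex p) := by
  intro h
  have hlim := tendsto_averageUnitVector hp
  have hK := hlim.isCompact_insert_range
  have hsub : insert 0 (Set.range (averageUnitVector p)) ⊆
      closure (convexHull ℝ (ellSimplex p)) := by
    rw [closure_convexHull_ellSimplex]
    exact Set.insert_subset ((isClosed_ellSimplex p).mem_of_tendsto hlim
      (Eventually.of_forall (averageUnitVector_mem_ellSimplex p)))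
      (Set.range_subset_iff.2 (averageUnitVector_mem_ellSimplex p))
  have hmem : ∀ n, uniformOnUnitVectors p n ∈ barycenterPreimage (ellSimplex p)
      (insert 0 (Set.range (averageUnitVector p))) := fun n =>
    ⟨_, Set.mem_insert_of_mem _ ⟨n, rfl⟩, hasBarycenter_uniformOnUnitVectors n⟩
  obtain ⟨μ, -, hμ⟩ := (h _ hsub hK).exists_mapClusterPt (f := atTop)
    (u := uniformOnUnitVectors p) (tendsto_principal.2 (Eventually.of_forall hmem))
  have hint : ∀ (f : BoundedContinuousFunction (ellSimplex p) ℝ) (c : ℝ),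
      Tendsto (fun n => ∫ y, f y ∂(uniformOnUnitVectors p n : Measure (ellSimplex p))) atTop
        (𝓝 c) → ∫ y, f y ∂(μ : Measure (ellSimplex p)) = c := by
    intro f c hc
    have h1 := hμ.continuousAt_comp
      (ProbabilityMeasure.continuous_integral_boundedContinuousFunction f).continuousAt
    -- The integral at `μ` is a cluster point of a convergent sequence, hence its limit.
    exact eq_of_nhds_neBot (ClusterPt.mono h1 hc)
  have hbar : HasBarycenter μ 0 := hasBarycenter_iff.2 fun φ => hint _ _ <| by
    have := (φ.continuous.tendsto 0).comp hlim
    refine this.congr fun n => ?_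
    exact (hasBarycenter_iff.1 (hasBarycenter_uniformOnUnitVectors n) φ).symm
  have hnorm : ∫ y, simplexNorm y ∂(μ : Measure (ellSimplex p)) = 1 := hint _ _ <| by
    refine tendsto_const_nhds.congr fun n => ?_
    rw [integral_uniformOnUnitVectors]
    have : ∀ i, simplexNorm ⟨_, single_mem_ellSimplex p i⟩ = (1 : ℝ) := fun i => by
      rw [simplexNorm_apply, lp.norm_single (zero_lt_one.trans_le Fact.out), norm_one]
    simp only [this, Finset.sum_const, Finset.card_range, nsmul_eq_mul, Nat.cast_add, Nat.cast_one]
    field_simp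
  have h0 : ∫⁻ y : ellSimplex p, seqTail 0 (y : EllP p) ∂(μ : Measure (ellSimplex p)) = 0 := by
    rw [hbar.lintegral_seqTail]
    simp [seqTail]
  rw [lintegral_eq_zero_iff (measurable_seqTail 0)] at h0
  have h2 : ∫ y, simplexNorm y ∂(μ : Measure (ellSimplex p)) = 0 := by
    refine integral_eq_zero_of_ae ?_
    filter_upwards [h0] with y hy
    have hy' := (enorm_le_seqTail (y : EllP p)).trans hy.le
    rw [simplexNorm_apply, Pi.zero_apply]
    exact norm_eq_zero.2 (enorm_eq_zero.1 (le_antisymm hy' bot_le))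
  rw [hnorm] at h2
  exact one_ne_zero h2

end NotMuCompact

theorem mainTheorem6 (p : ℝ≥0∞) [Fact (1 ≤ p)] (hp : 1 < p) :
    (IsPointwiseMuCompact (ellSimplex p) ∧ ¬ IsMuCompact (ellSimplex p)) ∧
      (IsMuCompact (ellSimplex 1) ∧
        ∃ ι : EllP 1 →L[ℝ] EllP p, (∀ x i, ι x i = x i) ∧
          Set.BijOn ι (ellSimplex 1) (ellSimplex p)) :=
  ⟨⟨isPointwiseMuCompact_ellSimplex p, not_isMuCompact_ellSimplex hp⟩,
    isMuCompact_ellSimplex_one, ellOneInclusion p,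
    fun x i => congrFun (coe_ellOneInclusion p x) i, bijOn_ellOneInclusion p⟩
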